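/- Let $(R,\mathfrak m)$ be a commutative Noetherian local ring of prime characteristic $p>0$ and of Krull dimension $d$, and let $t<d$ be a non-negative integer. The Frobenius endomorphism of $R$ induces a Frobenius action $F$ on each local cohomology module $H^i_{\mathfrak m}(R)$ (computed by the Čech complex on any finite set of elements generating $\mathfrak m$ up to radical, on which $F$ is the Frobenius map of each localization of $R$); $H^i_{\mathfrak m}(R)$ is called $F$-nilpotent if for every $\eta\in H^i_{\mathfrak m}(R)$ there is an $e$ with $F^e(\eta)=0$. A sequence $x_1,\dots,x_t$ of elements of $\mathfrak m$ is called filter regular if for each $i=1,\dots,t$ one has $x_i\notin P$ for every associated prime $P\neq\mathfrak m$ of $R/(x_1,\dots,x_{i-1})$. For an ideal $I$ of $R$ let $I:\mathfrak m^\infty=\bigcup_{n}(I:\mathfrak m^n)$, let $I^{[p^e]}$ be the ideal generated by the elements $a^{p^e}$ with $a\in I$, and let $I^F=\{a\in R: a^{p^e}\in I^{[p^e]}\text{ for some } e\ge 0\}$ be the Frobenius closure of $I$. Then the following are equivalent: 1. $H^i_{\mathfrak m}(R)$ is $F$-nilpotent for all $i\le t$. 2. There exists a filter regular sequence $x_1,\dots,x_t$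 in $R$ such that $$(x_1^{p^e},\dots,x_s^{p^e}):\mathfrak m^\infty\subseteq (x_1^{p^e},\dots,x_s^{p^e})^F$$ for all $0\le s\le t$ and all $e\ge 0$. -/

import Mathlib

/-! ## Frobenius powers, Frobenius closure, saturation -/

section FrobeniusClosure

variable {R : Type*} [CommRing R]

/-- The Frobenius power `I^[p^e]`: the expansion of `I` along `F^e : R → R`, `r ↦ r^(p^e)`. -/
def Ideal.frobeniusPower (p : ℕ) [ExpChar R p] (e : ℕ) (I : Ideal R) : Ideal R :=
  I.map (iterateFrobenius R p e)

theorem Ideal.pow_mem_frobeniusPower_of_le (p : ℕ) [ExpChar R p] {I : Ideal R} {a : R}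
    {e e' : ℕ} (h : e ≤ e') (ha : a ^ p ^ e ∈ I.frobeniusPower p e) :
    a ^ p ^ e' ∈ I.frobeniusPower p e' := by
  obtain ⟨k, rfl⟩ := Nat.exists_eq_add_of_le h
  have h1 := Ideal.mem_map_of_mem (iterateFrobenius R p k) ha
  have h2 : (iterateFrobenius R p k).comp (iterateFrobenius R p e) =
      iterateFrobenius R p (e + k) := by
    ext x
    simp [iterateFrobenius_def, pow_add, pow_mul]
  rw [Ideal.frobeniusPower, Ideal.map_map, h2, iterateFrobenius_def, ← pow_mul, ← pow_add] at h1
  exact h1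

/-- The Frobenius closure `I^F = {a | a^(p^e) ∈ I^[p^e] for some e}`. -/
def Ideal.frobeniusClosure (p : ℕ) [ExpChar R p] (I : Ideal R) : Ideal R where
  carrier := {a | ∃ e : ℕ, a ^ p ^ e ∈ I.frobeniusPower p e}
  zero_mem' := ⟨0, by simp⟩
  add_mem' := by
    rintro a b ⟨e, he⟩ ⟨e', he'⟩
    refine ⟨max e e', ?_⟩
    rw [← iterateFrobenius_def, map_add]
    exact Ideal.add_mem _ (Ideal.pow_mem_frobeniusPower_of_le p (le_max_left _ _) he)
      (Ideal.pow_mem_frobeniusPower_of_le p (le_max_right _ _) he')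
  smul_mem' := by
    rintro c a ⟨e, he⟩
    refine ⟨e, ?_⟩
    rw [smul_eq_mul, mul_pow]
    exact Ideal.mul_mem_left _ _ he

/-- The saturation `I : J^∞ = ⋃ₙ (I : Jⁿ)`. -/
def Ideal.colonInfty (I J : Ideal R) : Ideal R where
  carrier := {a | ∃ n : ℕ, ∀ b ∈ J ^ n, a * b ∈ I}
  zero_mem' := ⟨0, by simp⟩
  add_mem' := by
    rintro a a' ⟨n, hn⟩ ⟨m, hm⟩
    refine ⟨max n m, fun b hb => ?_⟩
    rw [add_mul]
    exact I.add_mem (hn b (Ideal.pow_le_pow_right (le_max_left _ _) hb))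
      (hm b (Ideal.pow_le_pow_right (le_max_right _ _) hb))
  smul_mem' := by
    rintro c a ⟨n, hn⟩
    refine ⟨n, fun b hb => ?_⟩
    rw [smul_eq_mul, mul_assoc]
    exact I.mul_mem_left c (hn b hb)

end FrobeniusClosure

/-! ## Filter regular sequences -/

/-- `x 0, …, x (t-1)` is a filter regular sequence on the module `M` over the local ring `R`:
all `x i` lie in the maximal ideal `𝔪`, and `x i` avoids every associated prime different from
`𝔪` of `M / (x 0, …, x (i-1)) M`. -/
def IsFilterRegularSeq {R : Type*} [CommRing R] [IsLocalRing R] (M : Type*) [AddCommGroup M]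
    [Module R M] {t : ℕ} (x : Fin t → R) : Prop :=
  (∀ i, x i ∈ IsLocalRing.maximalIdeal R) ∧
    ∀ i, ∀ P ∈ associatedPrimes R
        (M ⧸ (Ideal.span {a | ∃ j, j < i ∧ x j = a} • (⊤ : Submodule R M))),
      P ≠ IsLocalRing.maximalIdeal R → x i ∉ P

/-! ## Local cohomology of the ring through the Čech complex, with its Frobenius action -/

namespace CechLC

variable {R : Type*} [CommRing R] {n : ℕ}

/-- The localization `R_{y_S}` of `R` at the element `y_S = ∏_{i ∈ S} y i`. -/
abbrev Loc (y : Fin n → R) (S : Finset (Fin n)) : Type _ :=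
  Localization.Away (∏ i ∈ S, y i)

theorem isUnit_algebraMap_prod (y : Fin n → R) {S T : Finset (Fin n)} (h : S ⊆ T) :
    IsUnit (Algebra.ofId R (Loc y T) (∏ i ∈ S, y i)) :=
  isUnit_of_dvd_unit (map_dvd (Algebra.ofId R (Loc y T)) (Finset.prod_dvd_prod_of_subset S T y h))
    (IsLocalization.Away.algebraMap_isUnit (∏ i ∈ T, y i))

/-- The canonical map of `R`-algebras `R_{y_S} → R_{y_T}` for `S ⊆ T`. -/
noncomputable def res (y : Fin n → R) {S T : Finset (Fin n)} (h : S ⊆ T) :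
    Loc y S →ₐ[R] Loc y T :=
  IsLocalization.Away.liftAlgHom (∏ i ∈ S, y i) (f := Algebra.ofId R (Loc y T))
    (isUnit_algebraMap_prod y h)

/-- The term of degree `k` of the Čech complex of `R` on `y`: the direct sum of the `R_{y_S}` over
the `k`-element subsets `S` of the index set. -/
abbrev Cochain (y : Fin n → R) (k : ℕ) : Type _ :=
  ∀ S : {S : Finset (Fin n) // S.card = k}, Loc y S.1

/-- The Čech differential: `(d f)_T = ∑_{j ∈ T} (-1)^{#{i ∈ T | i < j}} f_{T ∖ {j}}|_T`. -/
noncomputable def d (y : Fin n → R) (k : ℕ) : Cochain y k →ₗ[R] Cochain y (k + 1) :=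
  LinearMap.pi fun T => ∑ j : {j // j ∈ T.1},
    ((-1 : ℤ) ^ (T.1.filter (· < j.1)).card) •
      ((res y (Finset.erase_subset j.1 T.1)).toLinearMap ∘ₗ
        LinearMap.proj (⟨T.1.erase j.1, by
          rw [Finset.card_erase_of_mem j.2, T.2, Nat.add_sub_cancel]⟩ :
            {S : Finset (Fin n) // S.card = k}))

theorem res_res (y : Fin n → R) {S T U : Finset (Fin n)} (h : S ⊆ T) (h' : T ⊆ U) (z : Loc y S) :
    res y h' (res y h z) = res y (h.trans h') z := by
  have : (res y h').toRingHom.comp (res y h).toRingHom = (res y (h.trans h')).toRingHom := by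
    refine IsLocalization.ringHom_ext (Submonoid.powers (∏ i ∈ S, y i)) ?_
    ext a
    simp
  exact congrArg (fun f => f z) this

theorem res_congr (y : Fin n → R) {k : ℕ} (f : Cochain y k) {T : Finset (Fin n)}
    {S S' : {S : Finset (Fin n) // S.card = k}} (h : S = S') (hS : S.1 ⊆ T) (hS' : S'.1 ⊆ T) :
    res y hS (f S) = res y hS' (f S') := by
  subst h; rfl

/-- The Čech differential squares to zero. -/
theorem d_d (y : Fin n → R) (k : ℕ) (f : Cochain y k) : d y (k + 1) (d y k f) = 0 := by
  ext T
  simp only [d, LinearMap.pi_apply, LinearMap.sum_apply, LinearMap.smul_apply,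
    LinearMap.comp_apply, LinearMap.proj_apply, AlgHom.toLinearMap_apply, map_sum, map_zsmul,
    Finset.smul_sum, smul_smul, res_res, Pi.zero_apply]
  rw [Finset.sum_sigma' (s := Finset.univ) (t := fun _ => Finset.univ)]
  refine Finset.sum_involution (fun q _ => ⟨⟨q.2.1, (Finset.mem_erase.1 q.2.2).2⟩, ⟨q.1.1,
    Finset.mem_erase.2 ⟨fun h => (Finset.mem_erase.1 q.2.2).1 h.symm, q.1.2⟩⟩⟩) ?_ ?_ ?_ ?_
  · rintro ⟨⟨i, hi⟩, ⟨j, hj⟩⟩ -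
    have hij := Finset.mem_erase.1 hj
    dsimp only
    have hc : ∀ a b, a ∈ T.1 → b ∈ T.1.erase a → ((T.1.erase a).erase b).card = k := by
      intro a b ha hb
      rw [Finset.card_erase_of_mem hb, Finset.card_erase_of_mem ha, T.2]
      rfl
    rw [res_congr y f (S := ⟨(T.1.erase i).erase j, hc i j hi hj⟩)
      (S' := ⟨(T.1.erase j).erase i, hc j i hij.2 (Finset.mem_erase.2 ⟨hij.1.symm, hi⟩)⟩)
      (Subtype.ext Finset.erase_right_comm) _
      ((Finset.erase_subset i (T.1.erase j)).trans (Finset.erase_subset j T.1)), ← add_smul]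
    convert zero_smul ℤ _
    rw [Finset.filter_erase, Finset.filter_erase]
    rcases lt_or_gt_of_ne hij.1 with h | h
    · rw [Finset.erase_eq_of_notMem (s := T.1.filter (· < j)) (by simp [h.le]),
        ← Finset.card_erase_add_one (s := T.1.filter (· < i)) (a := j) (by simp [h, hij.2])]
      ring
    · rw [Finset.erase_eq_of_notMem (s := T.1.filter (· < i)) (by simp [h.le]),
        ← Finset.card_erase_add_one (s := T.1.filter (· < j)) (a := i) (by simp [h, hi])]
      ring
  · rintro ⟨⟨i, hi⟩, ⟨j, hj⟩⟩ - - h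
    have hij := Finset.mem_erase.1 hj
    simp only [Sigma.mk.injEq, Subtype.mk.injEq] at h
    exact hij.1 h.1
  · intros; simp
  · intros; rfl

/-- The Čech cocycles of degree `k`. -/
noncomputable abbrev cocycles (y : Fin n → R) (k : ℕ) : Submodule R (Cochain y k) :=
  LinearMap.ker (d y k)

/-- The Čech coboundaries of degree `k`. -/
noncomputable def coboundaries (y : Fin n → R) : (k : ℕ) → Submodule R (Cochain y k)
  | 0 => ⊥
  | k + 1 => LinearMap.range (d y k)

/-- The `k`-th cohomology of the Čech complex of `R` on `y`, that is, the local cohomology module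
`H^k_I(R)` for every ideal `I` (of a Noetherian ring `R`) that `y` generates up to radical. -/
abbrev H (y : Fin n → R) (k : ℕ) : Type _ :=
  cocycles y k ⧸ (coboundaries y k).submoduleOf (cocycles y k)

section Frobenius

variable (p : ℕ) [ExpChar R p]

/-- The ring endomorphism `a / s ↦ a^p / s^p` of `R_{y_S}` induced by the Frobenius
endomorphism of `R`. -/
noncomputable def frobLoc (y : Fin n → R) (S : Finset (Fin n)) : Loc y S →+* Loc y S :=
  IsLocalization.map (M := Submonoid.powers (∏ i ∈ S, y i))
    (T := Submonoid.powers (∏ i ∈ S, y i)) (Loc y S) (frobenius R p)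
    (fun _ ha => Submonoid.pow_mem _ ha p)

theorem frobLoc_algebraMap (y : Fin n → R) (S : Finset (Fin n)) (a : R) :
    frobLoc p y S (algebraMap R (Loc y S) a) = algebraMap R (Loc y S) (a ^ p) :=
  IsLocalization.map_eq _ a

theorem frobLoc_res (y : Fin n → R) {S T : Finset (Fin n)} (h : S ⊆ T) (z : Loc y S) :
    frobLoc p y T (res y h z) = res y h (frobLoc p y S z) := by
  have : (frobLoc p y T).comp (res y h).toRingHom = (res y h).toRingHom.comp (frobLoc p y S) := by
    refine IsLocalization.ringHom_ext (Submonoid.powers (∏ i ∈ S, y i)) ?_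
    ext a
    simp [frobLoc_algebraMap]
  exact congrArg (fun f => f z) this

/-- The Frobenius map on the Čech cochains, componentwise the Frobenius of `R_{y_S}`. -/
noncomputable def frobCochain (y : Fin n → R) (k : ℕ) :
    Cochain y k →ₛₗ[frobenius R p] Cochain y k where
  toFun f S := frobLoc p y S.1 (f S)
  map_add' f g := by
    ext S
    simp
  map_smul' r f := by
    ext S
    simp [Algebra.smul_def, frobLoc_algebraMap, frobenius_def]

theorem d_frobCochain (y : Fin n → R) (k : ℕ) (f : Cochain y k) :
    d y k (frobCochain p y k f) = frobCochain p y (k + 1) (d y k f) := by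
  ext T
  simp [d, frobCochain, frobLoc_res]

/-- The Frobenius map on the Čech cocycles. -/
noncomputable def frobCocycles (y : Fin n → R) (k : ℕ) :
    cocycles y k →ₛₗ[frobenius R p] cocycles y k :=
  (frobCochain p y k).restrict fun f hf => by
    rw [LinearMap.mem_ker] at hf ⊢
    rw [d_frobCochain, hf, map_zero]

theorem frobCochain_mem_coboundaries (y : Fin n → R) (k : ℕ) (f : Cochain y k)
    (hf : f ∈ coboundaries y k) : frobCochain p y k f ∈ coboundaries y k := by
  cases k with
  | zero =>
    rw [coboundaries, Submodule.mem_bot] at hf ⊢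
    rw [hf, map_zero]
  | succ k =>
    obtain ⟨g, rfl⟩ := hf
    exact ⟨frobCochain p y k g, d_frobCochain p y k g⟩

/-- The Frobenius action on the local cohomology module `H y k`. -/
noncomputable def frobH (y : Fin n → R) (k : ℕ) : H y k →ₛₗ[frobenius R p] H y k :=
  Submodule.mapQ _ _ (frobCocycles p y k) fun f hf =>
    frobCochain_mem_coboundaries p y k f.1 hf

/-- `H y k` is `F`-nilpotent: the Frobenius action on it is nilpotent, that is, every element is
annihilated by some iterate of the action. -/
def IsFNilpotent (y : Fin n → R) (k : ℕ) : Prop :=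
  ∀ η : H y k, ∃ e : ℕ, (frobH p y k)^[e] η = 0

end Frobenius

end CechLC

/-! ### Powers of weakly regular sequences. -/

namespace RingTheory.Sequence

open Function Submodule

/-! Let `C` be the Čech complex on `y` and `I_s(q) = (x₀^q, …, x_{s-1}^q)`. Each `C^k` with `k > 0`
inverts elements of `𝔪`, so a filter regular sequence becomes weakly regular there, and so do its
powers (`mem_smul_top_of_pow_smul_mem`). Hence multiplication by `x_s^q` on `C/I_s(q)C` is injective
in positive degrees, with cokernel `C/I_{s+1}(q)C`. Frobenius induces relative maps `H^k(C/I_s(q)C)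
→ H^k(C/I_s(q p^e)C)`. In degree `0` the cohomology of `C/JC` is `(J : 𝔪^∞)/J`, so relative
nilpotence there says exactly that `J : 𝔪^∞ ⊆ J^F`.

(1 ⇒ 2) Any filter regular sequence works. The long exact sequence places `H^k(C/I_{s+1}(q)C)`
between cohomology of `C/I_s(q)C` in degrees `k` and `k+1`, so nilpotence in degrees `≤ t` for `s =
0` descends to degrees `≤ t - s` for `s` (`IsRelFNilpotent.succ`), and in particular to degree `0`.

(2 ⇒ 1) This is a hands-on form of the Nagel–Schenzel isomorphism `H^m_𝔪(R) ≅ colim_q (I_m(q) :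
𝔪^∞)/I_m(q)`, with transition maps given by multiplication by powers of `x₀⋯x_{m-1}`.
Positive-degree classes are `𝔪`-torsion, so each lifts through a connecting map; after `m` lifts it
is represented by an element of `R`, and regularity lets vanishing of its Frobenius iterates travel
back up (`Controls.succ`).

All arguments are carried out on cochains modulo `I_s(q)`, with no quotient complexes. -/

theorem quotSMulTop_map_injective {R M M' M'' : Type*} [CommRing R]
    [AddCommGroup M] [AddCommGroup M'] [AddCommGroup M''] [Module R M] [Module R M'] [Module R M'']
    {f : M →ₗ[R] M'} {g : M' →ₗ[R] M''} (hf : Injective f) (hfg : Exact f g)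
    {r : R} (hr : IsSMulRegular M'' r) : Injective (QuotSMulTop.map r f) := by
  rw [injective_iff_map_eq_zero]
  intro m hm
  obtain ⟨m, rfl⟩ := Submodule.Quotient.mk_surjective _ m
  rw [QuotSMulTop.map_apply_mk, Submodule.Quotient.mk_eq_zero,
    Submodule.mem_smul_pointwise_iff_exists] at hm
  obtain ⟨m', -, hm'⟩ := hm
  -- Regularity of `r` on `M''` plays the role of the vanishing of `Tor₁(R/r, M'')`.
  have h1 : r • g m' = 0 := by rw [← map_smul, hm', hfg.apply_apply_eq_zero]
  obtain ⟨m₀, rfl⟩ := (hfg m').1 (hr.right_eq_zero_of_smul h1)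
  rw [← map_smul] at hm'
  rw [Submodule.Quotient.mk_eq_zero, ← hf hm']
  exact Submodule.smul_mem_pointwise_smul _ _ _ trivial

/-- In a short exact sequence, a sequence which is weakly regular on both ends is weakly regular
on the middle term. -/
theorem IsWeaklyRegular.of_exact {R M M' M'' : Type*} [CommRing R]
    [AddCommGroup M] [AddCommGroup M'] [AddCommGroup M''] [Module R M] [Module R M'] [Module R M'']
    {f : M →ₗ[R] M'} {g : M' →ₗ[R] M''} (hf : Injective f) (hfg : Exact f g) (hg : Surjective g)
    {rs : List R} (h : IsWeaklyRegular M rs) (h'' : IsWeaklyRegular M'' rs) :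
    IsWeaklyRegular M' rs := by
  induction rs generalizing M M' M'' with
  | nil => simp
  | cons r rs ih =>
    rw [isWeaklyRegular_cons_iff] at h h'' ⊢
    refine ⟨isSMulRegular_of_range_eq_ker hf (LinearMap.exact_iff.1 hfg).symm h.1 h''.1, ?_⟩
    exact ih (quotSMulTop_map_injective hf hfg h''.1) (QuotSMulTop.map_exact r hfg hg)
      (QuotSMulTop.map_surjective r hg) h.2 h''.2

theorem IsWeaklyRegular.of_subsingleton {R M : Type*} [CommRing R] [AddCommGroup M] [Module R M]
    [Subsingleton M] (rs : List R) : IsWeaklyRegular M rs :=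
  ⟨fun _ _ _ _ _ => Subsingleton.elim _ _⟩

/-- Induction along `0 → M/r^k M → M/r^(k+1) M → M/rM → 0`, whose first map is multiplication by
`r`. -/
theorem IsWeaklyRegular.quotSMulTop_pow {R M : Type*} [CommRing R] [AddCommGroup M] [Module R M]
    {r : R} {rs : List R} (hr : IsSMulRegular M r) (h : IsWeaklyRegular (QuotSMulTop r M) rs)
    (k : ℕ) : IsWeaklyRegular (QuotSMulTop (r ^ k) M) rs := by
  induction k with
  | zero =>
    have : Subsingleton (QuotSMulTop (r ^ 0) M) := by
      rw [pow_zero, Submodule.Quotient.subsingleton_iff, one_smul]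
    exact .of_subsingleton rs
  | succ k ih =>
    let f : QuotSMulTop (r ^ k) M →ₗ[R] QuotSMulTop (r ^ (k + 1)) M :=
      Submodule.mapQ _ _ (LinearMap.lsmul R M r) (by
        intro m hm
        obtain ⟨a, -, rfl⟩ := (Submodule.mem_smul_pointwise_iff_exists _ _ _).1 hm
        rw [Submodule.mem_comap, LinearMap.lsmul_apply, smul_smul, ← pow_succ']
        exact Submodule.smul_mem_pointwise_smul _ _ _ trivial)
    let g : QuotSMulTop (r ^ (k + 1)) M →ₗ[R] QuotSMulTop r M :=
      Submodule.factor (by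
        intro m hm
        obtain ⟨a, -, rfl⟩ := (Submodule.mem_smul_pointwise_iff_exists _ _ _).1 hm
        rw [pow_succ', ← smul_smul]
        exact Submodule.smul_mem_pointwise_smul _ _ _ trivial)
    refine IsWeaklyRegular.of_exact (f := f) (g := g) ?_ ?_ ?_ ih h
    · rw [injective_iff_map_eq_zero]
      intro m hm
      obtain ⟨m, rfl⟩ := Submodule.Quotient.mk_surjective _ m
      rw [Submodule.mapQ_apply, Submodule.Quotient.mk_eq_zero,
        Submodule.mem_smul_pointwise_iff_exists] at hm
      obtain ⟨a, -, ha⟩ := hm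
      rw [pow_succ', ← smul_smul] at ha
      rw [Submodule.Quotient.mk_eq_zero, ← hr ha]
      exact Submodule.smul_mem_pointwise_smul _ _ _ trivial
    · intro m
      obtain ⟨m, rfl⟩ := Submodule.Quotient.mk_surjective _ m
      constructor
      · intro hm
        replace hm : (Submodule.Quotient.mk m : QuotSMulTop r M) = 0 := hm
        rw [Submodule.Quotient.mk_eq_zero, Submodule.mem_smul_pointwise_iff_exists] at hm
        obtain ⟨a, -, rfl⟩ := hm
        exact ⟨Submodule.Quotient.mk a, rfl⟩
      · rintro ⟨a, ha⟩
        obtain ⟨a, rfl⟩ := Submodule.Quotient.mk_surjective _ a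
        rw [← ha]
        change (Submodule.Quotient.mk (r • a) : QuotSMulTop r M) = 0
        rw [Submodule.Quotient.mk_eq_zero]
        exact Submodule.smul_mem_pointwise_smul _ _ _ trivial
    · exact Submodule.factor_surjective _

/-- Powers of a weakly regular sequence form a weakly regular sequence. -/
theorem IsWeaklyRegular.map_pow {R M : Type*} [CommRing R] [AddCommGroup M] [Module R M]
    {rs : List R} (h : IsWeaklyRegular M rs) (k : ℕ) : IsWeaklyRegular M (rs.map (· ^ k)) := by
  induction rs generalizing M with
  | nil => simp
  | cons r rs ih =>
    rw [isWeaklyRegular_cons_iff] at h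
    rw [List.map_cons, isWeaklyRegular_cons_iff]
    exact ⟨h.1.pow k, ih (.quotSMulTop_pow h.1 h.2 k)⟩

end RingTheory.Sequence

/-! ### Ideals of powers and their behaviour under Frobenius. -/

section PowIdeal

variable {R : Type*} [CommRing R]

/-- The ideal `(x₀^k, …, x_{s-1}^k)`. -/
def powIdeal (x : ℕ → R) (k s : ℕ) : Ideal R :=
  Ideal.ofList ((List.range s).map fun j => x j ^ k)

theorem powIdeal_zero (x : ℕ → R) (k : ℕ) : powIdeal x k 0 = ⊥ := by
  simp [powIdeal]

theorem powIdeal_succ (x : ℕ → R) (k s : ℕ) :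
    powIdeal x k (s + 1) = powIdeal x k s ⊔ Ideal.span {x s ^ k} := by
  simp [powIdeal, List.range_succ]

theorem powIdeal_eq_span (x : ℕ → R) (k s : ℕ) :
    powIdeal x k s = Ideal.span {a | ∃ j, j < s ∧ x j ^ k = a} := by
  simp [powIdeal, Ideal.ofList]

theorem frobeniusPower_powIdeal (p : ℕ) [ExpChar R p] (x : ℕ → R) (k s e : ℕ) :
    (powIdeal x k s).frobeniusPower p e = powIdeal x (k * p ^ e) s := by
  simp [powIdeal, Ideal.frobeniusPower, Function.comp_def, iterateFrobenius_def, pow_mul]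

/-- `(x₀ ⋯ x_{s-1})^N (x₀^k, …, x_{s-1}^k) ⊆ (x₀^{k+N}, …, x_{s-1}^{k+N})`. -/
theorem prod_pow_mul_mem_powIdeal (x : ℕ → R) (k N s : ℕ) {a : R} (ha : a ∈ powIdeal x k s) :
    (∏ j ∈ Finset.range s, x j) ^ N * a ∈ powIdeal x (k + N) s := by
  have : powIdeal x k s ≤
      Submodule.comap (LinearMap.lsmul R R ((∏ j ∈ Finset.range s, x j) ^ N))
        (powIdeal x (k + N) s) := by
    rw [powIdeal_eq_span, Ideal.span, Submodule.span_le]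
    rintro _ ⟨j, hj, rfl⟩
    obtain ⟨c, hc⟩ := Finset.dvd_prod_of_mem x (Finset.mem_range.2 hj)
    rw [SetLike.mem_coe, Submodule.mem_comap, LinearMap.lsmul_apply, smul_eq_mul]
    rw [hc, mul_pow, mul_right_comm, ← pow_add, add_comm N k, powIdeal_eq_span]
    exact Ideal.mul_mem_right _ _ (Ideal.subset_span ⟨j, hj, rfl⟩)
  exact this ha

end PowIdeal

/-! ### Filter regular elements and existence of filter regular sequences. -/

section FilterRegular

open IsLocalRing

variable {R : Type*} [CommRing R] [IsLocalRing R] [IsNoetherianRing R]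

/-- An element avoiding the associated primes `≠ 𝔪` of `R ⧸ I` is regular on `R ⧸ I` up to
`𝔪`-power torsion. -/
theorem mem_colonInfty_of_mul_mem {I : Ideal R} {z : R}
    (hz : ∀ P ∈ associatedPrimes R (R ⧸ I), P ≠ maximalIdeal R → z ∉ P) {a : R}
    (ha : z * a ∈ I) : a ∈ I.colonInfty (maximalIdeal R) := by
  let N : Submodule R (R ⧸ I) := Submodule.span R {Ideal.Quotient.mk I a}
  have hann : ∀ r, r ∈ Module.annihilator R N ↔ r * a ∈ I := by
    intro r
    rw [Submodule.mem_annihilator_span_singleton, ← Ideal.Quotient.eq_zero_iff_mem, map_mul]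
    rfl
  -- A minimal prime of the annihilator of the class of `a` is associated to `R ⧸ I` and contains
  -- `z`, so it can only be `𝔪`.
  have hle : maximalIdeal R ≤ (Module.annihilator R N).radical := by
    rw [← Ideal.sInf_minimalPrimes, le_sInf_iff]
    intro P hP
    have hP' : P ∈ associatedPrimes R N :=
      Module.associatedPrimes.minimalPrimes_annihilator_subset_associatedPrimes R N hP
    have hzP : z ∈ P := hP.1.2 ((hann z).2 ha)
    by_contra hne
    exact hz P (associatedPrimes.subset_of_injective N.injective_subtype hP')
      (fun h => hne h.ge) hzP
  obtain ⟨k, hk⟩ := Ideal.exists_pow_le_of_le_radical_of_fg hle (IsNoetherian.noetherian _)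
  exact ⟨k, fun b hb => by rw [mul_comm]; exact (hann b).1 (hk hb)⟩

/-- There is an element of `𝔪` avoiding all associated primes `≠ 𝔪` of `M`. -/
theorem exists_mem_maximalIdeal_forall_notMem (M : Type*) [AddCommGroup M] [Module R M]
    [Module.Finite R M] :
    ∃ z ∈ maximalIdeal R, ∀ P ∈ associatedPrimes R M, P ≠ maximalIdeal R → z ∉ P := by
  by_contra! h
  have hfin : (associatedPrimes R M \ {maximalIdeal R}).Finite :=
    (associatedPrimes.finite R M).subset Set.sdiff_subset
  have hsub : (maximalIdeal R : Set R) ⊆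
      ⋃ P ∈ hfin.toFinset, ((id P : Ideal R) : Set R) := by
    intro z hz
    obtain ⟨P, hP, hne, hzP⟩ := h z hz
    simp only [Set.Finite.mem_toFinset, Set.mem_iUnion]
    exact ⟨P, ⟨hP, hne⟩, hzP⟩
  obtain ⟨P, hP, hle⟩ := (Ideal.subset_union_prime ⊥ ⊥ fun P hP _ _ =>
    ((hfin.mem_toFinset.1 hP).1 : IsAssociatedPrime P M).isPrime).1 hsub
  have hP' := hfin.mem_toFinset.1 hP
  exact hP'.2 (((maximalIdeal.isMaximal R).eq_of_le
    (IsAssociatedPrime.isPrime hP'.1).ne_top hle).symm)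

/-- Filter regular sequences of any length exist. -/
theorem exists_isFilterRegularSeq (t : ℕ) : ∃ x : Fin t → R, IsFilterRegularSeq R x := by
  choose φ hφ hφ' using fun I : Ideal R =>
    exists_mem_maximalIdeal_forall_notMem (R := R) (R ⧸ (I • (⊤ : Submodule R R)))
  -- As `φ` depends only on the ideal already generated, the recursion runs on ideals alone.
  let J : ℕ → Ideal R := fun i => Nat.rec ⊥ (fun _ I => I ⊔ Ideal.span {φ I}) i
  have hJ : ∀ i, J i = Ideal.span {a | ∃ j, j < i ∧ φ (J j) = a} := by
    intro i
    induction i with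
    | zero => simp [J]
    | succ i ih =>
      change J i ⊔ Ideal.span {φ (J i)} = _
      conv_lhs => enter [1]; rw [ih]
      rw [← Ideal.span_union]
      congr 1
      ext a
      simp only [Set.mem_union, Set.mem_ofPred_eq, Set.mem_singleton_iff, Nat.lt_succ_iff_lt_or_eq]
      grind
  refine ⟨fun i => φ (J i), fun i => hφ _, fun i => ?_⟩
  have : Ideal.span {a | ∃ j : Fin t, j < i ∧ φ (J j) = a} = J i := by
    rw [hJ]
    congr 1
    ext a
    constructor
    · rintro ⟨j, hj, rfl⟩
      exact ⟨j, hj, rfl⟩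
    · rintro ⟨j, hj, rfl⟩
      exact ⟨⟨j, hj.trans i.2⟩, hj, rfl⟩
  rw [this]
  exact hφ' (J i)

end FilterRegular

/-! ### Clearing denominators in the Čech terms, modulo an ideal. -/

namespace CechLC

variable {R : Type*} [CommRing R] {n : ℕ}

/-- A cochain lies in `I C^k` if and only if its components lie in the extensions of `I`. -/
theorem mem_smul_top_iff (y : Fin n → R) {k : ℕ} (I : Ideal R) (f : Cochain y k) :
    f ∈ I • (⊤ : Submodule R (Cochain y k)) ↔
      ∀ S, f S ∈ I.map (algebraMap R (Loc y S.1)) := by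
  have key : ∀ (S : {S : Finset (Fin n) // S.card = k}) (z : Loc y S.1),
      z ∈ I.map (algebraMap R (Loc y S.1)) ↔ z ∈ I • (⊤ : Submodule R (Loc y S.1)) := by
    intro S z
    rw [Ideal.smul_top_eq_map, Submodule.restrictScalars_mem]
  simp only [key]
  constructor
  · intro hf S
    exact Submodule.smul_top_le_comap_smul_top I
      (LinearMap.proj (R := R) (φ := fun S : {S : Finset (Fin n) // S.card = k} => Loc y S.1) S) hf
  · intro hf
    have : f = ∑ S, LinearMap.single R
        (fun S : {S : Finset (Fin n) // S.card = k} => Loc y S.1) S (f S) := by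
      ext S
      simp [Finset.sum_apply]
    rw [this]
    exact Submodule.sum_mem _ fun S _ => Submodule.smul_top_le_comap_smul_top I
      (LinearMap.single R (fun S : {S : Finset (Fin n) // S.card = k} => Loc y S.1) S) (hf S)

theorem d_mem_smul_top (y : Fin n → R) {k : ℕ} {I : Ideal R} {f : Cochain y k}
    (hf : f ∈ I • (⊤ : Submodule R (Cochain y k))) :
    d y k f ∈ I • (⊤ : Submodule R (Cochain y (k + 1))) :=
  Submodule.smul_top_le_comap_smul_top I (d y k) hf

theorem isUnit_prod_of_subset (y : Fin n → R) {S T : Finset (Fin n)} (h : S ⊆ T) :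
    IsUnit (algebraMap R (Loc y T) (∏ i ∈ S, y i)) :=
  isUnit_algebraMap_prod y h

theorem exists_pow_smul_eq (y : Fin n → R) (S : Finset (Fin n)) (z : Loc y S) :
    ∃ (N : ℕ) (a : R), (∏ i ∈ S, y i) ^ N • z = algebraMap R (Loc y S) a := by
  obtain ⟨⟨a, ⟨_, N, rfl⟩⟩, h⟩ := IsLocalization.surj (Submonoid.powers (∏ i ∈ S, y i)) z
  refine ⟨N, a, ?_⟩
  rw [← h, Algebra.smul_def, mul_comm]

theorem algebraMap_mem_map_iff (y : Fin n → R) (S : Finset (Fin n)) (I : Ideal R) (a : R) :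
    algebraMap R (Loc y S) a ∈ I.map (algebraMap R (Loc y S)) ↔
      ∃ N : ℕ, (∏ i ∈ S, y i) ^ N * a ∈ I := by
  rw [IsLocalization.algebraMap_mem_map_algebraMap_iff (Submonoid.powers (∏ i ∈ S, y i))]
  constructor
  · rintro ⟨_, ⟨N, rfl⟩, h⟩
    exact ⟨N, h⟩
  · rintro ⟨N, h⟩
    exact ⟨_, ⟨N, rfl⟩, h⟩

theorem mem_map_of_prod_pow_smul_mem (y : Fin n → R) {S T : Finset (Fin n)} (h : S ⊆ T)
    {I : Ideal R} {N : ℕ} {z : Loc y T}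
    (hz : (∏ i ∈ S, y i) ^ N • z ∈ I.map (algebraMap R (Loc y T))) :
    z ∈ I.map (algebraMap R (Loc y T)) := by
  rw [Algebra.smul_def, map_pow] at hz
  exact (Ideal.unit_mul_mem_iff_mem _ ((isUnit_prod_of_subset y h).pow N)).1 hz

theorem smul_mem_map (y : Fin n → R) {S : Finset (Fin n)} {I : Ideal R} (r : R) {z : Loc y S}
    (hz : z ∈ I.map (algebraMap R (Loc y S))) : r • z ∈ I.map (algebraMap R (Loc y S)) := by
  rw [Algebra.smul_def]
  exact Ideal.mul_mem_left _ _ hz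

/-- `R_{y_T}` is the localization of `R_{y_S}` at `y i`; this and the next lemma are surjectivity
and injectivity up to powers of `y i`. -/
theorem exists_res_eq (y : Fin n → R) {S T : Finset (Fin n)} {i : Fin n} (hi : i ∉ S)
    (hT : insert i S = T) (h : S ⊆ T) (c : Loc y T) :
    ∃ (N : ℕ) (b : Loc y S), res y h b = y i ^ N • c := by
  obtain ⟨N, a, ha⟩ := exists_pow_smul_eq y T c
  have hu := (isUnit_prod_of_subset y (Finset.Subset.refl S)).pow N
  have hu' := (isUnit_prod_of_subset y h).pow N
  obtain ⟨b, hb⟩ := hu.dvd (a := algebraMap R (Loc y S) a)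
  refine ⟨N, b, hu'.mul_left_cancel ?_⟩
  have h1 : algebraMap R (Loc y T) (∏ i ∈ S, y i) ^ N =
      res y h (algebraMap R (Loc y S) (∏ i ∈ S, y i) ^ N) := by simp
  have hprod : ∏ i ∈ T, y i = y i * ∏ i ∈ S, y i := by rw [← hT, Finset.prod_insert hi]
  conv_lhs => rw [h1]
  rw [← map_mul, ← hb, AlgHom.commutes, ← ha, ← map_pow, ← Algebra.smul_def,
    smul_smul, ← mul_pow, mul_comm _ (y i), ← hprod]

theorem exists_pow_smul_mem_map (y : Fin n → R) {S T : Finset (Fin n)} {i : Fin n} (hi : i ∉ S)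
    (hT : insert i S = T) (h : S ⊆ T) {I : Ideal R} {c : Loc y S}
    (hc : res y h c ∈ I.map (algebraMap R (Loc y T))) :
    ∃ N : ℕ, y i ^ N • c ∈ I.map (algebraMap R (Loc y S)) := by
  obtain ⟨N, a, ha⟩ := exists_pow_smul_eq y S c
  have h1 : algebraMap R (Loc y T) a ∈ I.map (algebraMap R (Loc y T)) := by
    rw [← AlgHom.commutes (res y h), ← ha, map_smul]
    exact smul_mem_map y _ hc
  rw [algebraMap_mem_map_iff] at h1
  obtain ⟨M, hM⟩ := h1
  refine ⟨M, mem_map_of_prod_pow_smul_mem y (Finset.Subset.refl S) (N := N + M) ?_⟩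
  rw [← hT, Finset.prod_insert hi, mul_pow] at hM
  have : (∏ i ∈ S, y i) ^ (N + M) • y i ^ M • c =
      algebraMap R (Loc y S) (y i ^ M * (∏ i ∈ S, y i) ^ M * a) := by
    rw [map_mul, ← ha, ← Algebra.smul_def, smul_smul, smul_smul]
    congr 1
    ring
  rw [this]
  exact Ideal.mem_map_of_mem _ hM

/-- The `j`-th summand of the Čech differential at `T`. -/
noncomputable def dTerm (y : Fin n → R) {k : ℕ} (f : Cochain y k)
    (T : {T : Finset (Fin n) // T.card = k + 1}) (j : Fin n) : Loc y T.1 :=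
  if hj : j ∈ T.1 then
    ((-1 : R) ^ (T.1.filter (· < j)).card) • res y (Finset.erase_subset j T.1)
      (f ⟨T.1.erase j, by rw [Finset.card_erase_of_mem hj, T.2, Nat.add_sub_cancel]⟩)
  else 0

theorem d_apply (y : Fin n → R) {k : ℕ} (f : Cochain y k)
    (T : {T : Finset (Fin n) // T.card = k + 1}) : d y k f T = ∑ j ∈ T.1, dTerm y f T j := by
  rw [← Finset.sum_coe_sort]
  simp [d, dTerm, Algebra.smul_def]

/-- The face `S` is only propositionally `T.1.erase j`, which avoids casts between localizations. -/
theorem dTerm_eq (y : Fin n → R) {k : ℕ} (f : Cochain y k)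
    (T : {T : Finset (Fin n) // T.card = k + 1}) {j : Fin n} (hj : j ∈ T.1)
    (S : {S : Finset (Fin n) // S.card = k}) (hS : S.1 = T.1.erase j) (h : S.1 ⊆ T.1) :
    dTerm y f T j = ((-1 : R) ^ (T.1.filter (· < j)).card) • res y h (f S) := by
  obtain ⟨S, hSk⟩ := S
  subst hS
  simp [dTerm, hj]

end CechLC

/-! ### Contracting homotopy and torsion of the cohomology. -/

namespace CechLC

variable {R : Type*} [CommRing R] {n : ℕ}

/-- There are finitely many `T`, so one exponent serves them all. -/
theorem exists_uniform_res_eq (y : Fin n → R) {k : ℕ} (i : Fin n) (f : Cochain y (k + 1)) :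
    ∃ (N : ℕ) (b : Cochain y k), ∀ T U, i ∉ T.1 → insert i T.1 = U.1 → ∀ h : T.1 ⊆ U.1,
      res y h (b T) = y i ^ N • f U := by
  have key : ∀ T : {T : Finset (Fin n) // T.card = k}, ∃ (N : ℕ) (b : Loc y T.1),
      ∀ U : {U : Finset (Fin n) // U.card = k + 1}, i ∉ T.1 → insert i T.1 = U.1 → ∀ h : T.1 ⊆ U.1,
        res y h b = y i ^ N • f U := by
    intro T
    by_cases hi : i ∈ T.1
    · exact ⟨0, 0, fun U h => absurd hi h⟩
    · obtain ⟨N, b, hb⟩ := exists_res_eq y hi rfl (Finset.subset_insert i T.1)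
        (f ⟨insert i T.1, by rw [Finset.card_insert_of_notMem hi, T.2]⟩)
      refine ⟨N, b, ?_⟩
      rintro ⟨U, hU⟩ - rfl h
      exact hb
  choose N b hb using key
  refine ⟨Finset.univ.sup N, fun T => y i ^ (Finset.univ.sup N - N T) • b T, ?_⟩
  intro T U hi hU h
  rw [map_smul, hb T U hi hU h, smul_smul, ← pow_add,
    Nat.sub_add_cancel (Finset.le_sup (Finset.mem_univ T))]

/-- The sign rule behind `d ∘ d = 0`: removing `i` and `j` in the two orders gives opposite signs.
-/
theorem neg_one_pow_card_filter_insert_mul {S : Finset (Fin n)} {i j : Fin n} (hi : i ∉ S)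
    (hj : j ∈ S) :
    (-1 : R) ^ (S.filter (· < j)).card * (-1) ^ ((S.erase j).filter (· < i)).card =
      -((-1) ^ ((insert i S).filter (· < j)).card * (-1) ^ (S.filter (· < i)).card) := by
  have hij : i ≠ j := fun h => hi (h ▸ hj)
  rw [Finset.filter_erase, Finset.filter_insert]
  rcases lt_or_gt_of_ne hij with h | h
  · rw [if_pos h, Finset.card_insert_of_notMem (by simp [hi]),
      Finset.erase_eq_of_notMem (by simp [h.le])]
    ring
  · rw [if_neg (not_lt.2 h.le),
      ← Finset.card_erase_add_one (s := S.filter (· < i)) (a := j) (by simp [h, hj])]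
    ring

theorem neg_one_pow_mul_self (m : ℕ) : (-1 : R) ^ m * (-1) ^ m = 1 := by
  rw [← mul_pow]; simp

/-- The contracting homotopy of the Čech complex: a cocycle of positive degree modulo `J` becomes a
coboundary modulo `J` after multiplication by a power of `y i`. -/
theorem exists_pow_smul_mem_of_cocycle (y : Fin n → R) {k : ℕ} (i : Fin n) {J : Ideal R}
    {f : Cochain y (k + 1)} (hf : d y (k + 1) f ∈ J • (⊤ : Submodule R (Cochain y (k + 2)))) :
    ∃ N : ℕ, y i ^ N • f ∈ coboundaries y (k + 1) ⊔ J • ⊤ := by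
  obtain ⟨N, b, hb⟩ := exists_uniform_res_eq y i f
  -- The homotopy: `g_T` is, up to sign, `y i ^ N • f_{T ∪ {i}}` lifted to `R_{y_T}`.
  let g : Cochain y k := fun T =>
    if i ∈ T.1 then 0 else ((-1 : R) ^ (T.1.filter (· < i)).card) • b T
  have hcard : ∀ (S : {S : Finset (Fin n) // S.card = k + 1}) {j}, j ∈ S.1 →
      (S.1.erase j).card = k := fun S j hj => by
    rw [Finset.card_erase_of_mem hj, S.2, Nat.add_sub_cancel]
  have key : ∀ S : {S : Finset (Fin n) // S.card = k + 1}, ∃ M : ℕ,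
      y i ^ M • (y i ^ N • f S - d y k g S) ∈ J.map (algebraMap R (Loc y S.1)) := by
    intro S
    by_cases hi : i ∈ S.1
    -- If `i ∈ S`, only the face omitting `i` contributes, and equality is exact.
    · refine ⟨0, ?_⟩
      have : d y k g S = y i ^ N • f S := by
        rw [d_apply, Finset.sum_eq_single_of_mem i hi]
        · rw [dTerm_eq y g S hi ⟨S.1.erase i, hcard S hi⟩ rfl (Finset.erase_subset _ _)]
          simp only [g, Finset.notMem_erase, if_false, map_smul]
          rw [hb ⟨S.1.erase i, hcard S hi⟩ S (Finset.notMem_erase _ _) (Finset.insert_erase hi),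
            smul_smul, Finset.filter_erase, Finset.erase_eq_of_notMem (by simp),
            neg_one_pow_mul_self, one_smul]
        · intro j hj hji
          rw [dTerm_eq y g S hj ⟨S.1.erase j, hcard S hj⟩ rfl (Finset.erase_subset _ _)]
          simp [g, hi, hji.symm]
      rw [this, sub_self, smul_zero]
      exact Ideal.zero_mem _
    -- If `i ∉ S`, the cocycle condition at `S ∪ {i}` puts the difference in `J` after restriction;
    -- a further power of `y i` brings this back to `S`.
    · let U : {U : Finset (Fin n) // U.card = k + 2} :=
        ⟨insert i S.1, by rw [Finset.card_insert_of_notMem hi, S.2]⟩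
      have hSU : S.1 ⊆ U.1 := Finset.subset_insert i S.1
      refine exists_pow_smul_mem_map y hi rfl hSU ?_
      have hU := (mem_smul_top_iff y J _).1 hf U
      rw [d_apply, Finset.sum_insert hi,
        dTerm_eq y f U (Finset.mem_insert_self _ _) S (Finset.erase_insert hi).symm hSU] at hU
      have hε : (U.1.filter (· < i)).card = (S.1.filter (· < i)).card := by
        simp [U, Finset.filter_insert]
      have hg : res y hSU (d y k g S) = -(((-1 : R) ^ (S.1.filter (· < i)).card) •
          (y i ^ N • ∑ j ∈ S.1, dTerm y f U j)) := by
        rw [d_apply, map_sum, Finset.smul_sum, Finset.smul_sum, ← Finset.sum_neg_distrib]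
        refine Finset.sum_congr rfl fun j hj => ?_
        have hij : i ≠ j := fun h => hi (h ▸ hj)
        have hins : insert i (S.1.erase j) = U.1.erase j := by
          simp only [U]
          rw [Finset.erase_insert_of_ne hij]
        have hcU : (U.1.erase j).card = k + 1 := by
          rw [Finset.card_erase_of_mem (Finset.mem_insert_of_mem hj), U.2]; rfl
        have hi' : i ∉ S.1.erase j := fun h => hi (Finset.mem_of_mem_erase h)
        have hsub : S.1.erase j ⊆ U.1.erase j := Finset.erase_subset_erase _ hSU
        have hsign : (-1 : R) ^ (S.1.filter (· < j)).card *
            (-1) ^ ((S.1.erase j).filter (· < i)).card =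
              -((-1) ^ (U.1.filter (· < j)).card * (-1) ^ (S.1.filter (· < i)).card) :=
          neg_one_pow_card_filter_insert_mul hi hj
        rw [dTerm_eq y g S hj ⟨S.1.erase j, hcard S hj⟩ rfl (Finset.erase_subset _ _),
          dTerm_eq y f U (Finset.mem_insert_of_mem hj) ⟨U.1.erase j, hcU⟩ rfl
            (Finset.erase_subset _ _)]
        simp only [g, hi', if_false, map_smul, res_res]
        rw [← res_res y hsub (Finset.erase_subset _ _),
          hb ⟨S.1.erase j, hcard S hj⟩ ⟨U.1.erase j, hcU⟩ hi' hins hsub, map_smul, smul_smul,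
          smul_smul, smul_smul, smul_smul, ← neg_smul, hsign]
        congr 1
        ring
      rw [map_sub, map_smul, hg, sub_neg_eq_add]
      have : y i ^ N • res y hSU (f S) + ((-1 : R) ^ (S.1.filter (· < i)).card) •
          (y i ^ N • ∑ j ∈ S.1, dTerm y f U j) = y i ^ N • ((-1 : R) ^ (S.1.filter (· < i)).card) •
          (((-1 : R) ^ (U.1.filter (· < i)).card) • res y hSU (f S) +
            ∑ j ∈ S.1, dTerm y f U j) := by
        rw [hε, smul_add ((-1 : R) ^ _), smul_smul ((-1 : R) ^ _) ((-1 : R) ^ _),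
          neg_one_pow_mul_self, one_smul, smul_add, smul_comm (y i ^ N) ((-1 : R) ^ _)]
      rw [this]
      exact smul_mem_map y _ (smul_mem_map y _ hU)
  choose M hM using key
  refine ⟨Finset.univ.sup M + N, ?_⟩
  have h1 : y i ^ Finset.univ.sup M • (y i ^ N • f - d y k g) ∈
      J • (⊤ : Submodule R (Cochain y (k + 1))) := by
    rw [mem_smul_top_iff]
    intro S
    have := smul_mem_map y (y i ^ (Finset.univ.sup M - M S)) (hM S)
    rw [smul_smul, ← pow_add, Nat.sub_add_cancel (Finset.le_sup (Finset.mem_univ S))] at this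
    exact this
  have h2 : y i ^ (Finset.univ.sup M + N) • f = d y k (y i ^ Finset.univ.sup M • g) +
      y i ^ Finset.univ.sup M • (y i ^ N • f - d y k g) := by
    rw [map_smul, smul_sub, smul_smul, pow_add]
    abel
  rw [h2]
  exact Submodule.add_mem_sup ⟨_, rfl⟩ h1

/-- The cohomology of positive degree of `C ⧸ J C` is torsion with respect to the radical of the
ideal generated by `y`. -/
theorem exists_pow_smul_mem_of_mem_radical (y : Fin n → R) {k : ℕ} {J : Ideal R}
    {f : Cochain y (k + 1)} (hf : d y (k + 1) f ∈ J • (⊤ : Submodule R (Cochain y (k + 2))))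
    {x : R} (hx : x ∈ (Ideal.span (Set.range y)).radical) :
    ∃ N : ℕ, x ^ N • f ∈ coboundaries y (k + 1) ⊔ J • ⊤ := by
  let 𝔞 : Ideal R := Submodule.comap (LinearMap.toSpanSingleton R _ f)
    (coboundaries y (k + 1) ⊔ J • ⊤)
  have hle : Ideal.span (Set.range y) ≤ 𝔞.radical := by
    rw [Ideal.span_le]
    rintro _ ⟨i, rfl⟩
    obtain ⟨N, hN⟩ := exists_pow_smul_mem_of_cocycle y i hf
    exact ⟨N, hN⟩
  exact (Ideal.radical_le_radical_iff.2 hle) hx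

/-! ### Degree zero -/

/-- The only index is `∅`, and localizing at the empty product changes nothing. -/
theorem exists_eq_algebraMap (y : Fin n → R) (f : Cochain y 0) :
    ∃ a : R, f = algebraMap R (Cochain y 0) a := by
  obtain ⟨N, a, ha⟩ := exists_pow_smul_eq y ∅ (f ⟨∅, Finset.card_empty⟩)
  refine ⟨a, ?_⟩
  ext ⟨S, hS⟩
  obtain rfl := Finset.card_eq_zero.1 hS
  have h1 : (∏ i ∈ (∅ : Finset (Fin n)), y i) ^ N = 1 := by simp
  rw [h1, one_smul] at ha
  exact ha

theorem algebraMap_mem_smul_top_iff (y : Fin n → R) (J : Ideal R) (a : R) :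
    algebraMap R (Cochain y 0) a ∈ J • (⊤ : Submodule R (Cochain y 0)) ↔ a ∈ J := by
  rw [mem_smul_top_iff]
  constructor
  · intro h
    obtain ⟨N, hN⟩ := (algebraMap_mem_map_iff y ∅ J a).1 (h ⟨∅, Finset.card_empty⟩)
    simpa using hN
  · intro h S
    exact Ideal.mem_map_of_mem _ h

theorem d_algebraMap_apply (y : Fin n → R) (a : R) (T : {T : Finset (Fin n) // T.card = 0 + 1})
    {i : Fin n} (hT : T.1 = {i}) :
    d y 0 (algebraMap R (Cochain y 0) a) T = algebraMap R (Loc y T.1) a := by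
  obtain ⟨T, hT'⟩ := T
  subst hT
  rw [d_apply, Finset.sum_singleton,
    dTerm_eq y _ _ (Finset.mem_singleton_self i) ⟨∅, Finset.card_empty⟩ (by simp)
      (Finset.empty_subset _)]
  simp [Finset.filter_singleton]

/-- The zeroth cohomology of `C ⧸ J C` is the `I`-power torsion of `R ⧸ J`, for `I` the radical of
the ideal generated by `y`. -/
theorem d_algebraMap_mem_iff [IsNoetherianRing R] (y : Fin n → R) (J : Ideal R) (a : R) :
    d y 0 (algebraMap R (Cochain y 0) a) ∈ J • (⊤ : Submodule R (Cochain y (0 + 1))) ↔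
      a ∈ J.colonInfty (Ideal.span (Set.range y)).radical := by
  rw [mem_smul_top_iff]
  constructor
  · intro h
    let 𝔞 : Ideal R := Submodule.comap (LinearMap.toSpanSingleton R R a) J
    have hle : Ideal.span (Set.range y) ≤ 𝔞.radical := by
      rw [Ideal.span_le]
      rintro _ ⟨i, rfl⟩
      have := h ⟨{i}, Finset.card_singleton i⟩
      rw [d_algebraMap_apply y a ⟨{i}, Finset.card_singleton i⟩ rfl, algebraMap_mem_map_iff] at this
      obtain ⟨N, hN⟩ := this
      rw [Finset.prod_singleton] at hN
      exact ⟨N, hN⟩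
    obtain ⟨N, hN⟩ := Ideal.exists_pow_le_of_le_radical_of_fg
      (Ideal.radical_le_radical_iff.2 hle) (IsNoetherian.noetherian _)
    exact ⟨N, fun b hb => by rw [mul_comm]; exact hN hb⟩
  · rintro ⟨N, hN⟩ T
    obtain ⟨i, hi⟩ := Finset.card_eq_one.1 T.2
    rw [d_algebraMap_apply y a T hi, algebraMap_mem_map_iff, hi, Finset.prod_singleton]
    refine ⟨N, ?_⟩
    rw [mul_comm]
    exact hN _ (Ideal.pow_mem_pow (Ideal.le_radical (Ideal.subset_span (Set.mem_range_self i))) N)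

end CechLC

namespace CechLC

variable {R : Type*} [CommRing R] {n : ℕ}

/-! ### Filter regular sequences on cochains of positive degree -/

/-- For nonempty `S`, inverting `∏ i ∈ S, y i`, an element of `𝔪`, kills the `𝔪`-power torsion that
obstructs regularity of `z` modulo `I`. -/
theorem mem_map_of_smul_mem_map (y : Fin n → R) {𝔪 : Ideal R} (hy : ∀ i, y i ∈ 𝔪)
    {S : Finset (Fin n)} (hS : S.Nonempty) {I : Ideal R} {z : R}
    (hz : ∀ a, z * a ∈ I → a ∈ I.colonInfty 𝔪) {c : Loc y S}
    (hc : z • c ∈ I.map (algebraMap R (Loc y S))) : c ∈ I.map (algebraMap R (Loc y S)) := by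
  obtain ⟨N, a, ha⟩ := exists_pow_smul_eq y S c
  refine mem_map_of_prod_pow_smul_mem y (Finset.Subset.refl S) (N := N) ?_
  rw [ha, algebraMap_mem_map_iff]
  have h1 : algebraMap R (Loc y S) (z * a) ∈ I.map (algebraMap R (Loc y S)) := by
    rw [map_mul, ← Algebra.smul_def, ← ha, smul_comm]
    exact smul_mem_map y _ hc
  obtain ⟨M, hM⟩ := (algebraMap_mem_map_iff y S I _).1 h1
  rw [mul_left_comm] at hM
  obtain ⟨L, hL⟩ := hz _ hM
  obtain ⟨i, hi⟩ := hS
  refine ⟨L + M, ?_⟩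
  have := hL _ (Ideal.pow_mem_pow (Ideal.mem_of_dvd _ (Finset.dvd_prod_of_mem y hi) (hy i)) L)
  rwa [mul_comm, ← mul_assoc, ← pow_add] at this

theorem isWeaklyRegular_loc (y : Fin n → R) {𝔪 : Ideal R} (hy : ∀ i, y i ∈ 𝔪)
    {S : Finset (Fin n)} (hS : S.Nonempty) {x : ℕ → R} {t : ℕ}
    (hx : ∀ i < t, ∀ a, x i * a ∈ powIdeal x 1 i → a ∈ (powIdeal x 1 i).colonInfty 𝔪) :
    RingTheory.Sequence.IsWeaklyRegular (Loc y S) ((List.range t).map x) := by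
  refine ⟨fun i hi => ?_⟩
  have hi' : i < t := by simpa using hi
  have htake : Ideal.ofList (((List.range t).map x).take i) = powIdeal x 1 i := by
    simp [powIdeal, ← List.map_take, List.take_range, hi'.le]
  rw [htake, isSMulRegular_quotient_iff_mem_of_smul_mem]
  intro c hc
  rw [Ideal.smul_top_eq_map, Submodule.restrictScalars_mem] at hc ⊢
  refine mem_map_of_smul_mem_map y hy hS (hx i hi') ?_
  simpa using hc

/-- If `x` is a filter regular sequence, then `x s ^ q` is regular modulo
`(x 0 ^ q, …, x (s-1) ^ q)` on the Čech cochains of positive degree. -/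
theorem mem_smul_top_of_pow_smul_mem (y : Fin n → R) {𝔪 : Ideal R} (hy : ∀ i, y i ∈ 𝔪)
    {x : ℕ → R} {t : ℕ}
    (hx : ∀ i < t, ∀ a, x i * a ∈ powIdeal x 1 i → a ∈ (powIdeal x 1 i).colonInfty 𝔪)
    {s : ℕ} (hs : s < t) (q : ℕ) {k : ℕ} {f : Cochain y (k + 1)}
    (hf : x s ^ q • f ∈ powIdeal x q s • (⊤ : Submodule R (Cochain y (k + 1)))) :
    f ∈ powIdeal x q s • (⊤ : Submodule R (Cochain y (k + 1))) := by
  rw [mem_smul_top_iff] at hf ⊢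
  intro S
  have hS : S.1.Nonempty := Finset.card_pos.1 (by rw [S.2]; exact k.succ_pos)
  have hreg := ((isWeaklyRegular_loc y hy hS hx).map_pow q).regular_mod_prev s (by simpa using hs)
  have htake : Ideal.ofList ((((List.range t).map x).map (· ^ q)).take s) = powIdeal x q s := by
    simp [powIdeal, ← List.map_take, List.take_range, hs.le, Function.comp_def]
  rw [htake, isSMulRegular_quotient_iff_mem_of_smul_mem] at hreg
  have := hreg (f S)
  rw [Ideal.smul_top_eq_map, Submodule.restrictScalars_mem, Submodule.restrictScalars_mem] at this
  refine this ?_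
  simpa using hf S

/-! ### Frobenius on cochains -/

section Frobenius

variable (p : ℕ) [ExpChar R p] (y : Fin n → R)

theorem iterate_frobCochain_smul (k e : ℕ) (r : R) (f : Cochain y k) :
    (frobCochain p y k)^[e] (r • f) = r ^ p ^ e • (frobCochain p y k)^[e] f := by
  induction e with
  | zero => simp
  | succ e ih =>
    rw [Function.iterate_succ_apply', ih, map_smulₛₗ, Function.iterate_succ_apply',
      frobenius_def, ← pow_mul, ← pow_succ]

theorem d_iterate_frobCochain (k e : ℕ) (f : Cochain y k) :
    d y k ((frobCochain p y k)^[e] f) = (frobCochain p y (k + 1))^[e] (d y k f) := by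
  induction e with
  | zero => rfl
  | succ e ih => rw [Function.iterate_succ_apply', d_frobCochain, ih, Function.iterate_succ_apply']

theorem iterate_frobCochain_algebraMap (k e : ℕ) (a : R) :
    (frobCochain p y k)^[e] (algebraMap R (Cochain y k) a) =
      algebraMap R (Cochain y k) (a ^ p ^ e) := by
  induction e with
  | zero => simp
  | succ e ih =>
    rw [Function.iterate_succ_apply', ih, pow_succ, pow_mul]
    ext S
    exact frobLoc_algebraMap p y S.1 _

theorem iterate_frobCochain_mem_coboundaries {k : ℕ} (e : ℕ) {f : Cochain y k}
    (hf : f ∈ coboundaries y k) : (frobCochain p y k)^[e] f ∈ coboundaries y k := by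
  induction e with
  | zero => exact hf
  | succ e ih =>
    rw [Function.iterate_succ_apply']
    exact frobCochain_mem_coboundaries p y k _ ih

/-- This is what makes the relative Frobenius well defined, from level `q` to level `q * p ^ e`. -/
theorem iterate_frobCochain_mem_smul_top (x : ℕ → R) (q s : ℕ) {k : ℕ} (e : ℕ) {f : Cochain y k}
    (hf : f ∈ powIdeal x q s • (⊤ : Submodule R (Cochain y k))) :
    (frobCochain p y k)^[e] f ∈ powIdeal x (q * p ^ e) s • (⊤ : Submodule R (Cochain y k)) := by
  refine Submodule.smul_induction_on hf (fun r hr g _ => ?_) (fun g h hg hh => ?_)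
  · rw [iterate_frobCochain_smul, ← frobeniusPower_powIdeal p x q s e, ← iterateFrobenius_def]
    exact Submodule.smul_mem_smul (Ideal.mem_map_of_mem _ hr) trivial
  · rw [iterate_map_add]
    exact Submodule.add_mem _ hg hh

theorem isFNilpotent_iff (k : ℕ) :
    IsFNilpotent p y k ↔ ∀ f : Cochain y k, d y k f = 0 →
      ∃ e : ℕ, (frobCochain p y k)^[e] f ∈ coboundaries y k := by
  have hiter : ∀ (e : ℕ) (f : cocycles y k), ∃ g : cocycles y k,
      g.1 = (frobCochain p y k)^[e] f.1 ∧
      (frobH p y k)^[e] (Submodule.Quotient.mk f) = Submodule.Quotient.mk g := by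
    intro e f
    induction e with
    | zero => exact ⟨f, rfl, rfl⟩
    | succ e ih =>
      obtain ⟨g, hg, hg'⟩ := ih
      refine ⟨frobCocycles p y k g, ?_, ?_⟩
      · rw [Function.iterate_succ_apply', ← hg]
        rfl
      · rw [Function.iterate_succ_apply', hg']
        rfl
  constructor
  · intro h f hf
    obtain ⟨e, he⟩ := h (Submodule.Quotient.mk ⟨f, hf⟩)
    obtain ⟨g, hg, hg'⟩ := hiter e ⟨f, hf⟩
    rw [hg', Submodule.Quotient.mk_eq_zero] at he
    exact ⟨e, hg ▸ he⟩
  · intro h η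
    obtain ⟨f, rfl⟩ := Submodule.Quotient.mk_surjective _ η
    obtain ⟨e, he⟩ := h f.1 f.2
    obtain ⟨g, hg, hg'⟩ := hiter e f
    refine ⟨e, ?_⟩
    rw [hg', Submodule.Quotient.mk_eq_zero]
    exact (hg ▸ he : g.1 ∈ coboundaries y k)

/-! ### Descent of nilpotence along a filter regular sequence. -/

/-- The relative Frobenius action on the cohomology in degree `k` of the Čech complex of
`R ⧸ (x 0 ^ q, …, x (s-1) ^ q)` is nilpotent for all `q`. -/
def IsRelFNilpotent (x : ℕ → R) (s k : ℕ) : Prop :=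
  ∀ (q : ℕ) (f : Cochain y k),
    d y k f ∈ powIdeal x q s • (⊤ : Submodule R (Cochain y (k + 1))) →
    ∃ e : ℕ, (frobCochain p y k)^[e] f ∈
      coboundaries y k ⊔ powIdeal x (q * p ^ e) s • (⊤ : Submodule R (Cochain y k))

variable {p y}

theorem IsFNilpotent.isRelFNilpotent {k : ℕ} (h : IsFNilpotent p y k) (x : ℕ → R) :
    IsRelFNilpotent p y x 0 k := by
  intro q f hf
  rw [powIdeal_zero, Submodule.bot_smul, Submodule.mem_bot] at hf
  obtain ⟨e, he⟩ := (isFNilpotent_iff p y k).1 h f hf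
  exact ⟨e, Submodule.mem_sup_left he⟩

theorem mem_powIdeal_succ_smul_top_iff {x : ℕ → R} {q s : ℕ} {M : Type*} [AddCommGroup M]
    [Module R M] {m : M} : m ∈ powIdeal x q (s + 1) • (⊤ : Submodule R M) ↔
      ∃ g ∈ powIdeal x q s • (⊤ : Submodule R M), ∃ h, m = g + x s ^ q • h := by
  rw [powIdeal_succ, Submodule.sup_smul, Submodule.ideal_span_singleton_smul, Submodule.mem_sup]
  constructor
  · rintro ⟨g, hg, h, hh, rfl⟩
    obtain ⟨h, -, rfl⟩ := (Submodule.mem_smul_pointwise_iff_exists _ _ _).1 hh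
    exact ⟨g, hg, h, rfl⟩
  · rintro ⟨g, hg, h, rfl⟩
    exact ⟨g, hg, _, Submodule.smul_mem_pointwise_smul _ _ _ trivial, rfl⟩

theorem d_eq_zero_of_mem_coboundaries {k : ℕ} {f : Cochain y k} (hf : f ∈ coboundaries y k) :
    d y k f = 0 := by
  cases k with
  | zero =>
    rw [coboundaries, Submodule.mem_bot] at hf
    rw [hf, map_zero]
  | succ k =>
    obtain ⟨g, rfl⟩ := hf
    exact d_d y k g

/-- A chase in the long exact sequence for multiplication by `x s ^ q`: one Frobenius iterate kills
the connecting image in degree `k + 1`, a second kills what then lifts to degree `k`. Injectivity is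
needed only in degree `k + 2`. -/
theorem IsRelFNilpotent.succ {x : ℕ → R} {s k : ℕ}
    (hreg : ∀ (q : ℕ) (f : Cochain y (k + 2)),
      x s ^ q • f ∈ powIdeal x q s • (⊤ : Submodule R (Cochain y (k + 2))) →
      f ∈ powIdeal x q s • (⊤ : Submodule R (Cochain y (k + 2))))
    (h : IsRelFNilpotent p y x s k) (h' : IsRelFNilpotent p y x s (k + 1)) :
    IsRelFNilpotent p y x (s + 1) k := by
  intro q f hf
  obtain ⟨g, hg, w, hw⟩ := mem_powIdeal_succ_smul_top_iff.1 hf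
  -- `w` represents the image of `f` under the connecting map.
  have hdw : d y (k + 1) w ∈ powIdeal x q s • (⊤ : Submodule R (Cochain y (k + 2))) := by
    refine hreg q _ ?_
    have h0 := d_d y k f
    rw [hw, map_add, map_smul] at h0
    rw [eq_neg_of_add_eq_zero_right h0]
    exact Submodule.neg_mem _ (d_mem_smul_top y hg)
  obtain ⟨e, he⟩ := h' q w hdw
  obtain ⟨_, ⟨u, rfl⟩, g', hg', hsum⟩ := Submodule.mem_sup.1 he
  -- As `F^e w` is `d u` modulo the ideal, this correction of `F^e f` by a multiple of `x s ^ (q * p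
  -- ^ e)` is a cocycle already at stage `s`.
  have hdu : d y k ((frobCochain p y k)^[e] f - x s ^ (q * p ^ e) • u) ∈
      powIdeal x (q * p ^ e) s • (⊤ : Submodule R (Cochain y (k + 1))) := by
    rw [map_sub, d_iterate_frobCochain, hw, iterate_map_add, iterate_frobCochain_smul, ← hsum,
      map_smul, ← pow_mul, smul_add, add_sub_assoc, add_sub_cancel_left]
    exact Submodule.add_mem _ (iterate_frobCochain_mem_smul_top p y x q s e hg)
      (Submodule.smul_mem _ _ hg')
  obtain ⟨e', he'⟩ := h _ _ hdu
  refine ⟨e' + e, ?_⟩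
  rw [iterate_map_sub, ← Function.iterate_add_apply, iterate_frobCochain_smul, ← pow_mul,
    mul_assoc, ← pow_add, add_comm e e'] at he'
  obtain ⟨b, hb, c, hc, hbc⟩ := Submodule.mem_sup.1 he'
  rw [eq_sub_iff_add_eq] at hbc
  rw [← hbc, add_assoc]
  exact Submodule.add_mem_sup hb (mem_powIdeal_succ_smul_top_iff.2 ⟨c, hc, _, rfl⟩)

/-- The `F`-nilpotence of the cohomology of `R` in degrees `≤ t` passes to the quotients by
filter regular sequences. -/
theorem isRelFNilpotent_of_isFNilpotent {x : ℕ → R} {t : ℕ}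
    (hreg : ∀ s < t, ∀ (q k : ℕ) (f : Cochain y (k + 1)),
      x s ^ q • f ∈ powIdeal x q s • (⊤ : Submodule R (Cochain y (k + 1))) →
      f ∈ powIdeal x q s • (⊤ : Submodule R (Cochain y (k + 1))))
    (h : ∀ i ≤ t, IsFNilpotent p y i) (s : ℕ) :
    ∀ k, s + k ≤ t → IsRelFNilpotent p y x s k := by
  induction s with
  | zero => exact fun k hk => (h k (by omega)).isRelFNilpotent x
  | succ s ih =>
    intro k hk
    exact (ih k (by omega)).succ (fun q f => hreg s (by omega) q (k + 1) f)
      (ih (k + 1) (by omega))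

/-! ### Lowering a cohomology class to degree zero. -/

theorem prod_pow_smul_mem_smul_top (x : ℕ → R) (q N s : ℕ) {M : Type*} [AddCommGroup M]
    [Module R M] {m : M} (hm : m ∈ powIdeal x q s • (⊤ : Submodule R M)) :
    (∏ j ∈ Finset.range s, x j) ^ N • m ∈ powIdeal x (q + N) s • (⊤ : Submodule R M) := by
  refine Submodule.smul_induction_on hm (fun r hr g _ => ?_) (fun g h hg hh => ?_)
  · rw [smul_smul]
    exact Submodule.smul_mem_smul (prod_pow_mul_mem_powIdeal x q N s hr) trivial
  · rw [smul_add]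
    exact Submodule.add_mem _ hg hh

theorem prod_pow_smul_mem_sup (x : ℕ → R) (q N s : ℕ) {k : ℕ} {f : Cochain y k}
    (hf : f ∈ coboundaries y k ⊔ powIdeal x q s • (⊤ : Submodule R (Cochain y k))) :
    (∏ j ∈ Finset.range s, x j) ^ N • f ∈
      coboundaries y k ⊔ powIdeal x (q + N) s • (⊤ : Submodule R (Cochain y k)) := by
  obtain ⟨g, hg, h, hh, rfl⟩ := Submodule.mem_sup.1 hf
  rw [smul_add]
  exact Submodule.add_mem_sup (Submodule.smul_mem _ _ hg) (prod_pow_smul_mem_smul_top x q N s hh)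

variable (p y) in
/-- The cochain `g` of degree `k` is a cocycle modulo `(x 0 ^ q, …, x (s-1) ^ q)` and controls the
vanishing of the Frobenius iterates of the class of `f`: if `F^e g` vanishes in the direct limit of
the cohomology modulo powers of `x 0, …, x (s-1)`, then `F^e f` is a coboundary. -/
def Controls (x : ℕ → R) (s q : ℕ) {k m : ℕ} (g : Cochain y k) (f : Cochain y m) : Prop :=
  d y k g ∈ powIdeal x q s • (⊤ : Submodule R (Cochain y (k + 1))) ∧
    ∀ e N : ℕ, (∏ j ∈ Finset.range s, x j) ^ N • (frobCochain p y k)^[e] g ∈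
        coboundaries y k ⊔ powIdeal x (q * p ^ e + N) s • (⊤ : Submodule R (Cochain y k)) →
      (frobCochain p y m)^[e] f ∈ coboundaries y m

/-- Moves `g` along the direct system; `F^e` turns the factor's exponent `r` into `r * p ^ e`, which
is absorbed into `N`. -/
theorem Controls.prod_pow_smul {x : ℕ → R} {s q : ℕ} {k m : ℕ} {g : Cochain y k}
    {f : Cochain y m} (h : Controls p y x s q g f) (r : ℕ) :
    Controls p y x s (q + r) ((∏ j ∈ Finset.range s, x j) ^ r • g) f := by
  refine ⟨?_, fun e N hN => h.2 e (r * p ^ e + N) ?_⟩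
  · rw [map_smul]
    exact prod_pow_smul_mem_smul_top x q r s h.1
  · rw [iterate_frobCochain_smul, smul_smul, ← pow_mul, ← pow_add, add_comm N] at hN
    rwa [← add_assoc, ← add_mul]

/-- The class of `g` is killed by a power of `x s`, hence comes through the connecting map from a
class `u` one degree lower, modulo one more element. Regularity of `x s` cancels the extra factor
when vanishing of `F^e u` is carried back to `g`. -/
theorem Controls.succ {x : ℕ → R} {s q : ℕ} {k m : ℕ} {g : Cochain y (k + 1)}
    (hreg : ∀ (q : ℕ) (f : Cochain y (k + 1)),
      x s ^ q • f ∈ powIdeal x q s • (⊤ : Submodule R (Cochain y (k + 1))) →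
      f ∈ powIdeal x q s • (⊤ : Submodule R (Cochain y (k + 1))))
    (hxs : x s ∈ (Ideal.span (Set.range y)).radical)
    {f : Cochain y m} (h : Controls p y x s q g f) :
    ∃ (q' : ℕ) (u : Cochain y k), Controls p y x (s + 1) q' u f := by
  obtain ⟨r, hr⟩ := exists_pow_smul_mem_of_mem_radical y h.1 hxs
  have h' := h.prod_pow_smul r
  -- Passing to level `q + r` gives `x s` the same exponent as the earlier elements.
  set g' := (∏ j ∈ Finset.range s, x j) ^ r • g with hg'
  have hmem : x s ^ (q + r) • g' ∈ coboundaries y (k + 1) ⊔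
      powIdeal x (q + r) s • (⊤ : Submodule R (Cochain y (k + 1))) := by
    rw [hg', smul_comm, pow_add, ← smul_smul]
    exact prod_pow_smul_mem_sup x q r s (Submodule.smul_mem _ _ hr)
  obtain ⟨_, ⟨u, rfl⟩, w, hw, hsum⟩ := Submodule.mem_sup.1 hmem
  refine ⟨q + r, u, ?_, fun e N hN => h'.2 e N ?_⟩
  · refine mem_powIdeal_succ_smul_top_iff.2 ⟨-w, Submodule.neg_mem _ hw, g', ?_⟩
    rw [← hsum]
    abel
  · set Q := (q + r) * p ^ e with hQ
    obtain ⟨b, hb, c, hc, hbc⟩ := Submodule.mem_sup.1 hN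
    obtain ⟨c, hc', v, rfl⟩ := mem_powIdeal_succ_smul_top_iff.1 hc
    have h1 : (∏ j ∈ Finset.range (s + 1), x j) ^ N • (frobCochain p y (k + 1))^[e] (d y k u) =
        d y k c + x s ^ (Q + N) • d y k v := by
      rw [← d_iterate_frobCochain, ← map_smul, ← hbc, map_add, d_eq_zero_of_mem_coboundaries hb,
        zero_add, map_add, map_smul]
    have h2 : (frobCochain p y (k + 1))^[e] (d y k u) =
        x s ^ Q • (frobCochain p y (k + 1))^[e] g' - (frobCochain p y (k + 1))^[e] w := by
      rw [eq_sub_of_add_eq hsum, iterate_map_sub, iterate_frobCochain_smul, ← pow_mul]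
    -- Differentiating the vanishing of `F^e u` leaves a relation divisible by `x s ^ (Q + N)`
    -- modulo the first `s` powers, which is then cancelled.
    have h3 : (∏ j ∈ Finset.range s, x j) ^ N • (frobCochain p y (k + 1))^[e] g' - d y k v ∈
        powIdeal x (Q + N) s • (⊤ : Submodule R (Cochain y (k + 1))) := by
      refine hreg _ _ ?_
      have h4 : x s ^ (Q + N) •
          ((∏ j ∈ Finset.range s, x j) ^ N • (frobCochain p y (k + 1))^[e] g' - d y k v) =
          d y k c + x s ^ N •
            ((∏ j ∈ Finset.range s, x j) ^ N • (frobCochain p y (k + 1))^[e] w) := by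
        rw [h2, Finset.prod_range_succ, mul_pow] at h1
        rw [eq_sub_iff_add_eq.2 h1.symm]
        module
      rw [h4]
      exact Submodule.add_mem _ (d_mem_smul_top y hc') (Submodule.smul_mem _ _
        (prod_pow_smul_mem_smul_top x Q N s (iterate_frobCochain_mem_smul_top p y x _ s e hw)))
    have h5 : (∏ j ∈ Finset.range s, x j) ^ N • (frobCochain p y (k + 1))^[e] g' = d y k v +
        ((∏ j ∈ Finset.range s, x j) ^ N • (frobCochain p y (k + 1))^[e] g' - d y k v) := by
      abel
    rw [h5]
    exact Submodule.add_mem_sup ⟨v, rfl⟩ h3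

theorem exists_controls {x : ℕ → R} {m : ℕ}
    (hreg : ∀ s < m, ∀ (q k : ℕ) (f : Cochain y (k + 1)),
      x s ^ q • f ∈ powIdeal x q s • (⊤ : Submodule R (Cochain y (k + 1))) →
      f ∈ powIdeal x q s • (⊤ : Submodule R (Cochain y (k + 1))))
    (hx : ∀ s < m, x s ∈ (Ideal.span (Set.range y)).radical)
    {f : Cochain y m} (hf : d y m f = 0) (s : ℕ) :
    ∀ k, s + k = m → ∃ (q : ℕ) (g : Cochain y k), Controls p y x s q g f := by
  induction s with
  | zero =>
    intro k hk
    obtain rfl : k = m := by omega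
    -- For `s = 0` the ideal is `⊥` and the product is empty, so the level is immaterial.
    refine ⟨0, f, ?_, fun e N h => ?_⟩
    · rw [hf]
      exact Submodule.zero_mem _
    · simpa [powIdeal_zero] using h
  | succ s ih =>
    intro k hk
    obtain ⟨q, g, h⟩ := ih (k + 1) (by omega)
    exact h.succ (fun q f => hreg s (by omega) q k f) (hx s (by omega))

end Frobenius

end CechLC

/-! ### Saturations, Frobenius closures and the equivalence. -/

section Main

open IsLocalRing

/-- The extension by zero of a finite sequence. -/
def extendByZero {R : Type*} [Zero R] {t : ℕ} (x : Fin t → R) (j : ℕ) : R :=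
  if h : j < t then x ⟨j, h⟩ else 0

theorem powIdeal_extendByZero {R : Type*} [CommRing R] {t : ℕ} (x : Fin t → R) (q : ℕ) {s : ℕ}
    (hs : s ≤ t) : powIdeal (extendByZero x) q s =
      Ideal.span {a | ∃ j : Fin t, (j : ℕ) < s ∧ x j ^ q = a} := by
  rw [powIdeal_eq_span]
  congr 1
  ext a
  constructor
  · rintro ⟨j, hj, rfl⟩
    exact ⟨⟨j, hj.trans_le hs⟩, hj, by simp [extendByZero, hj.trans_le hs]⟩
  · rintro ⟨j, hj, rfl⟩
    exact ⟨j, hj, by simp [extendByZero]⟩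

variable {R : Type*} [CommRing R]

theorem IsFilterRegularSeq.mem_colonInfty [IsLocalRing R] [IsNoetherianRing R] {t : ℕ}
    {x : Fin t → R} (hx : IsFilterRegularSeq R x) (i : ℕ) (hi : i < t) (a : R)
    (ha : extendByZero x i * a ∈ powIdeal (extendByZero x) 1 i) :
    a ∈ (powIdeal (extendByZero x) 1 i).colonInfty (maximalIdeal R) := by
  refine mem_colonInfty_of_mul_mem ?_ ha
  have h := hx.2 ⟨i, hi⟩
  have hI : Ideal.span {a | ∃ j, j < (⟨i, hi⟩ : Fin t) ∧ x j = a} • (⊤ : Submodule R R) =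
      powIdeal (extendByZero x) 1 i := by
    rw [powIdeal_extendByZero x 1 hi.le, smul_eq_mul, Ideal.mul_top]
    simp only [pow_one]
    rfl
  rw [hI] at h
  simpa [extendByZero, hi] using h

theorem IsFilterRegularSeq.extendByZero_mem [IsLocalRing R] {t : ℕ} {x : Fin t → R}
    (hx : IsFilterRegularSeq R x) (i : ℕ) (hi : i < t) : extendByZero x i ∈ maximalIdeal R := by
  simpa [extendByZero, hi] using hx.1 ⟨i, hi⟩

namespace CechLC

variable [IsNoetherianRing R] {p : ℕ} [ExpChar R p] {n : ℕ} {y : Fin n → R} {x : ℕ → R}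

/-- Nilpotence of the relative Frobenius action in degree `0` bounds the saturation by the
Frobenius closure. -/
theorem IsRelFNilpotent.colonInfty_le {s : ℕ} (h : IsRelFNilpotent p y x s 0) (q : ℕ) :
    (powIdeal x q s).colonInfty (Ideal.span (Set.range y)).radical ≤
      (powIdeal x q s).frobeniusClosure p := by
  intro a ha
  obtain ⟨e, he⟩ := h q _ ((d_algebraMap_mem_iff y _ a).2 ha)
  rw [coboundaries, bot_sup_eq, iterate_frobCochain_algebraMap, algebraMap_mem_smul_top_iff,
    ← frobeniusPower_powIdeal] at he
  exact ⟨e, he⟩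

theorem isFNilpotent_of_colonInfty_le {m : ℕ} (hp : 1 < p)
    (hreg : ∀ s < m, ∀ (q k : ℕ) (f : Cochain y (k + 1)),
      x s ^ q • f ∈ powIdeal x q s • (⊤ : Submodule R (Cochain y (k + 1))) →
      f ∈ powIdeal x q s • (⊤ : Submodule R (Cochain y (k + 1))))
    (hx : ∀ s < m, x s ∈ (Ideal.span (Set.range y)).radical)
    (h : ∀ e : ℕ, (powIdeal x (p ^ e) m).colonInfty (Ideal.span (Set.range y)).radical ≤
      (powIdeal x (p ^ e) m).frobeniusClosure p) : IsFNilpotent p y m := by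
  rw [isFNilpotent_iff]
  intro f hf
  obtain ⟨q, g, hg⟩ := exists_controls (p := p) hreg hx hf m 0 rfl
  -- The hypothesis concerns only powers of `p`, so the level is raised from `q` to `p ^ q > q`.
  have hg' := hg.prod_pow_smul (p ^ q - q)
  rw [Nat.add_sub_cancel' (Nat.lt_pow_self hp).le] at hg'
  obtain ⟨a, ha⟩ := exists_eq_algebraMap y ((∏ j ∈ Finset.range m, x j) ^ (p ^ q - q) • g)
  rw [ha] at hg'
  obtain ⟨e, he⟩ := h q ((d_algebraMap_mem_iff y _ a).1 hg'.1)
  refine ⟨e, hg'.2 e 0 (Submodule.mem_sup_right ?_)⟩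
  rw [pow_zero, one_smul, add_zero, iterate_frobCochain_algebraMap, algebraMap_mem_smul_top_iff,
    ← frobeniusPower_powIdeal]
  exact he

end CechLC

end Main

theorem mainTheorem10 {R : Type*} [CommRing R] [IsLocalRing R] [IsNoetherianRing R]
    (p : ℕ) [Fact p.Prime] [CharP R p]
    (d : ℕ) (hd : ringKrullDim R = d) (t : ℕ) (ht : t < d)
    -- `H^i_𝔪(R)` is computed by the Čech complex on any generators `y` of `𝔪` up to radical
    {n : ℕ} (y : Fin n → R)
    (hy : (Ideal.span (Set.range y)).radical = IsLocalRing.maximalIdeal R) :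
    (∀ i ≤ t, CechLC.IsFNilpotent p y i) ↔
      ∃ x : Fin t → R, IsFilterRegularSeq R x ∧
        ∀ s ≤ t, ∀ e : ℕ,
          (Ideal.span {a | ∃ j : Fin t, (j : ℕ) < s ∧ x j ^ p ^ e = a}).colonInfty
              (IsLocalRing.maximalIdeal R) ≤
            (Ideal.span {a | ∃ j : Fin t, (j : ℕ) < s ∧ x j ^ p ^ e = a}).frobeniusClosure p := by
  have hym : ∀ i, y i ∈ IsLocalRing.maximalIdeal R := fun i =>
    hy ▸ Ideal.le_radical (Ideal.subset_span (Set.mem_range_self i))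
  constructor
  · intro h
    obtain ⟨x, hx⟩ := exists_isFilterRegularSeq (R := R) t
    refine ⟨x, hx, fun s hs e => ?_⟩
    rw [← powIdeal_extendByZero x _ hs, ← hy]
    exact (CechLC.isRelFNilpotent_of_isFNilpotent (fun s hs q k f =>
      CechLC.mem_smul_top_of_pow_smul_mem y hym hx.mem_colonInfty hs q) h s 0 hs).colonInfty_le _
  · rintro ⟨x, hx, h⟩ i hi
    -- Degree `i` uses the hypothesis only for `s = i`.
    refine CechLC.isFNilpotent_of_colonInfty_le (x := extendByZero x)
      (Fact.out : p.Prime).one_lt (fun s hs q k f => CechLC.mem_smul_top_of_pow_smul_mem y hym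
        hx.mem_colonInfty (hs.trans_le hi) q) ?_ fun e => ?_
    · rw [hy]
      exact fun s hs => hx.extendByZero_mem s (hs.trans_le hi)
    · rw [powIdeal_extendByZero x _ hi, hy]
      exact h i hi e
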